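/- An edge coloring of the complete graph $K_n$ on $n$ labeled vertices is a Gallai coloring if it contains no rainbow triangle, that is, no triangle whose three edges have pairwise distinct colors. Let $c(n,k)$ be the number of Gallai colorings of $K_n$ with colors from a fixed set of $k$ colors (not all of which have to be used), and let $c_2(n,k)$ be the number of those in which exactly two colors occur. For every $\varepsilon>0$ there is an $n_0$ such that for all integers $n\ge n_0$ and all integers $k$ with $2<k\le 2^{n/4300}$, $$\left|c(n,k)-\binom k2\,2^{\binom n2}\right|\le \varepsilon\,2^{\binom n2}\qquad\text{and}\qquad c_2(n,k)\ge(1-\varepsilon)\,c(n,k).$$ In other words, $c(n,k)=\left(\binom k2+o_n(1)\right)2^{\binom n2}$ uniformly for $2<k\le 2^{n/4300}$, and almost all Gallai $k$-colorings in this range use only two colors. -/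

import Mathlib

namespace GallaiColoring

/-- An edge coloring of the complete graph on `V` is a Gallai coloring if it has no rainbow
triangle: no triangle `x y z` has three edges of pairwise distinct colors. -/
def IsGallai {V K : Type*} (φ : SimpleGraph.TopEdgeLabeling V K) : Prop :=
  ∀ (x y z : V) (hxy : x ≠ y) (hyz : y ≠ z) (hxz : x ≠ z),
    ¬ (φ.get x y hxy ≠ φ.get y z hyz ∧ φ.get y z hyz ≠ φ.get x z hxz ∧
      φ.get x y hxy ≠ φ.get x z hxz)

/-- `gallaiColorings n k` is the set of Gallai colorings of the labeled complete graph `K_n` with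
colors from a fixed set of `k` colors, not all of which have to be used. -/
def gallaiColorings (n k : ℕ) : Set (SimpleGraph.TopEdgeLabeling (Fin n) (Fin k)) :=
  {φ | IsGallai φ}

/-- `c n k` is the number of Gallai `k`-colorings of `K_n`. -/
noncomputable def c (n k : ℕ) : ℕ := (gallaiColorings n k).ncard

/-- The set of colors that occur on the edges. -/
def usedColors {V K : Type*} (φ : SimpleGraph.TopEdgeLabeling V K) : Set K := Set.range φ

/-- The number of Gallai `k`-colorings of `K_n` in which exactly two colors occur. -/
noncomputable def cTwo (n k : ℕ) : ℕ :=
  {φ | φ ∈ gallaiColorings n k ∧ (usedColors φ).ncard = 2}.ncard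

end GallaiColoring

/-!
Let `c m` be the number of Gallai `k`-colorings of `K_m`. The colorings with at most two colors
number `(k.choose 2) * 2 ^ (n.choose 2)` up to `k ^ 2`, so it has to be shown that those with at
least three colors are negligible.

By Gallai's theorem (`NoRainbow.exists_isCut`), a Gallai coloring with at least three colors has a
color that occurs and whose color class is disconnected. A component of this class with at least
one edge is homogeneous: every outside vertex sees it in one color
(`NoRainbow.exists_homogeneous`). Restricting to a homogeneous set of size `s`, and contracting it
to a point, determines the coloring, whence (`c_le`)

  `c n ≤ (k.choose 2) * 2 ^ (n.choose 2) + ∑ 2 ≤ s < n, (n.choose s) * c s * c (n - s + 1)`.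

For `a m = c m / 2 ^ (m.choose 2)` the summand acquires the factor `2 ^ (-(s - 1) * (n - s))`. Let
`k ≤ 2 ^ r` with `r` about `n / 4300`. The recursion first gives the crude bound
`a m ≤ 2 ^ (6 * r * (m - 1))`. With it applied to the smaller of the two parts only, induction on
`m` gives `a m ≤ 2 ^ (2 * r) + 2 ^ (400 * r ^ 2 - 4 * r * m)`: for `m ≤ 40 * r` this is the crude
bound, and for larger `m` the factor `2 ^ (-(s - 1) * (m - s))` wins (`term_le`). The second term
is at most `1` when `m = n`, and one more use of the recursion yields
`a n ≤ k.choose 2 + 2 ^ (-r)` (`le_add_inv_of_recursion`).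
-/

namespace GallaiColoring

/-! ### Structure of Gallai colorings -/

section Structure

variable {α K : Type*}

/-- The coloring of pairs of elements of `S` by `f` has no rainbow triangle. Edge colorings are
represented here by total functions, whose values on the diagonal are ignored. -/
def NoRainbow (f : α → α → K) (S : Set α) : Prop :=
  ∀ x ∈ S, ∀ y ∈ S, ∀ z ∈ S, x ≠ y → y ≠ z → x ≠ z →
    ¬ (f x y ≠ f y z ∧ f y z ≠ f x z ∧ f x y ≠ f x z)

/-- The color `r` occurs on an edge inside `S`. -/
def ColorUsed (f : α → α → K) (S : Set α) (r : K) : Prop :=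
  ∃ x ∈ S, ∃ y ∈ S, x ≠ y ∧ f x y = r

/-- `x` and `y` lie in the same component of the graph formed by the edges of color `r`
inside `S`. -/
def Linked (f : α → α → K) (S : Set α) (r : K) : α → α → Prop :=
  Relation.ReflTransGen fun x y => x ∈ S ∧ y ∈ S ∧ x ≠ y ∧ f x y = r

/-- `A` is a nonempty proper subset of `S` that no edge of color `r` leaves. -/
def IsCut (f : α → α → K) (S : Set α) (r : K) (A : Set α) : Prop :=
  A ⊆ S ∧ A.Nonempty ∧ A ≠ S ∧ ∀ x ∈ A, ∀ y ∈ S, y ∉ A → f x y ≠ r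

variable {f : α → α → K} {S : Set α} {r : K}

theorem Linked.mem {x y : α} (hx : x ∈ S) (h : Linked f S r x y) : y ∈ S := by
  induction h with
  | refl => exact hx
  | tail _ h _ => exact h.2.1

theorem Linked.symm (hf : ∀ x y, f x y = f y x) {x y : α} (h : Linked f S r x y) :
    Linked f S r y x := by
  induction h with
  | refl => exact Relation.ReflTransGen.refl
  | tail _ h ih => exact Relation.ReflTransGen.head ⟨h.2.1, h.1, h.2.2.1.symm, hf _ _ ▸ h.2.2.2⟩ ih

theorem Linked.mem_of_isCut {A : Set α} (hA : IsCut f S r A) {x y : α} (hx : x ∈ A)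
    (h : Linked f S r x y) : y ∈ A := by
  induction h with
  | refl => exact hx
  | tail _ h ih =>
    by_contra hy
    exact hA.2.2.2 _ ih _ h.2.1 hy h.2.2.2

theorem IsCut.exists_not_linked (hf : ∀ x y, f x y = f y x) {A : Set α} (hA : IsCut f S r A)
    (x : α) : ∃ z ∈ S, ¬ Linked f S r x z := by
  by_contra! hall
  obtain ⟨hAS, ⟨a, ha⟩, hne, -⟩ := id hA
  refine hne (Set.Subset.antisymm hAS fun z hz => ?_)
  have : Linked f S r a z :=
    Relation.ReflTransGen.trans (Linked.symm hf (hall a (hAS ha))) (hall z hz)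
  exact this.mem_of_isCut hA ha

/-- An edge of color `r` would link its endpoints. -/
theorem ne_of_not_linked {x y : α} (hx : x ∈ S) (hy : y ∈ S) (h : ¬ Linked f S r x y) :
    f x y ≠ r := by
  intro hr
  refine h (Relation.ReflTransGen.single ⟨hx, hy, ?_, hr⟩)
  rintro rfl
  exact h Relation.ReflTransGen.refl

/-- A vertex outside a component of a color class sees that whole component in one color. -/
theorem NoRainbow.eq_of_linked (hf : ∀ x y, f x y = f y x) (hG : NoRainbow f S) {w a b : α}
    (hw : w ∈ S) (hab : Linked f S r a b) (haw : ¬ Linked f S r a w) :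
    f w b = f w a := by
  induction hab with
  | refl => rfl
  | @tail b c hb h ih =>
    obtain ⟨hbS, hcS, hbc, hr⟩ := h
    have hc : Linked f S r a c := hb.tail ⟨hbS, hcS, hbc, hr⟩
    have hbw : ¬ Linked f S r b w := fun h => haw (Relation.ReflTransGen.trans hb h)
    have hcw : ¬ Linked f S r c w := fun h => haw (Relation.ReflTransGen.trans hc h)
    have h1 := ne_of_not_linked hbS hw hbw
    have h2 := ne_of_not_linked hcS hw hcw
    have hwb : w ≠ b := by rintro rfl; exact haw hb
    have hwc : w ≠ c := by rintro rfl; exact haw hc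
    have := hG w hw b hbS c hcS hwb hbc hwc
    rw [hf] at h1 h2
    rw [← ih]
    by_contra hne
    exact this ⟨hr ▸ h1, hr ▸ h2.symm, fun h => hne h.symm⟩

/-- If an `r`-disconnected set becomes `r`-connected on adding `v`, then `v` sees at most two
colors: a vertex in another component, joined to `v` in color `r`, compares any two of the other
colors at `v`. -/
theorem NoRainbow.eq_of_linked_insert (hf : ∀ x y, f x y = f y x) {v : α} (hv : v ∉ S)
    (hG : NoRainbow f (insert v S)) {A : Set α} (hA : IsCut f S r A)
    (hconn : ∀ x ∈ S, ∃ y, Linked f S r x y ∧ f v y = r) {u w : α} (hu : u ∈ S) (hw : w ∈ S)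
    (hur : f v u ≠ r) (hwr : f v w ≠ r) : f v u = f v w := by
  have hGS : NoRainbow f S := fun x hx y hy z hz =>
    hG x (Set.mem_insert_of_mem _ hx) y (Set.mem_insert_of_mem _ hy) z (Set.mem_insert_of_mem _ hz)
  have vne : ∀ x ∈ S, v ≠ x := by rintro x hx rfl; exact hv hx
  have key : ∀ x ∈ S, f v x ≠ r → ∀ y ∈ S, f v y = r → ¬ Linked f S r x y → f x y = f v x := by
    intro x hx hxr y hy hyr hxy
    have hxy' : x ≠ y := by rintro rfl; exact hxy Relation.ReflTransGen.refl
    have h1 := ne_of_not_linked hx hy hxy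
    have := hG v (Set.mem_insert _ _) x (Set.mem_insert_of_mem _ hx) y
      (Set.mem_insert_of_mem _ hy) (vne x hx) hxy' (vne y hy)
    rw [hyr] at this
    by_contra h
    exact this ⟨fun h' => h h'.symm, h1, hxr⟩
  by_cases huw : Linked f S r u w
  · obtain ⟨z, hz, huz⟩ := hA.exists_not_linked hf u
    obtain ⟨y, hzy, hy⟩ := hconn z hz
    have hyS := hzy.mem hz
    have huy : ¬ Linked f S r u y := fun h =>
      huz (Relation.ReflTransGen.trans h (Linked.symm hf hzy))
    have hwy : ¬ Linked f S r w y := fun h => huy (Relation.ReflTransGen.trans huw h)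
    rw [← key u hu hur y hyS hy huy, ← key w hw hwr y hyS hy hwy, hf u, hf w]
    exact (hGS.eq_of_linked hf hyS huw huy).symm
  · obtain ⟨w', hww', hw'⟩ := hconn w hw
    obtain ⟨u', huu', hu'⟩ := hconn u hu
    have hwu : ¬ Linked f S r w u := fun h => huw (Linked.symm hf h)
    have h1 : ¬ Linked f S r u w' := fun h =>
      huw (Relation.ReflTransGen.trans h (Linked.symm hf hww'))
    have h2 : ¬ Linked f S r w u' := fun h =>
      hwu (Relation.ReflTransGen.trans h (Linked.symm hf huu'))
    rw [← key u hu hur w' (hww'.mem hw) hw' h1, ← key w hw hwr u' (huu'.mem hu) hu' h2,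
      hGS.eq_of_linked hf hu hww' hwu, hGS.eq_of_linked hf hw huu' huw, hf]

/-- Gallai's theorem: in a coloring with at least three colors and no rainbow triangle, some color
that occurs has a disconnected color class. -/
theorem NoRainbow.exists_isCut (hf : ∀ x y, f x y = f y x) (S : Finset α)
    (hG : NoRainbow f S) {p q s : K} (hpq : p ≠ q) (hps : p ≠ s) (hqs : q ≠ s)
    (hp : ColorUsed f S p) (hq : ColorUsed f S q) (hs : ColorUsed f S s) :
    ∃ r A, ColorUsed f S r ∧ IsCut f S r A := by
  classical
  induction S using Finset.induction_on generalizing p q s with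
  | empty => obtain ⟨x, hx, -⟩ := hp; simp at hx
  | insert v S hv ih =>
    rw [Finset.coe_insert] at *
    have hvS : v ∉ (S : Set α) := by simpa using hv
    have vne : ∀ x ∈ S, v ≠ x := by rintro x hx rfl; exact hv hx
    by_contra! hno
    -- a color that misses `v` is cut by `{v}`
    have seen : ∀ g, ColorUsed f (insert v (S : Set α)) g → ∃ u ∈ S, f v u = g := by
      intro g hg
      by_contra! h
      refine hno g {v} hg ⟨by simp, by simp, ?_, ?_⟩
      · intro h'
        obtain ⟨x, hx, y, hy, hxy, -⟩ := hg
        rw [← h'] at hx hy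
        simp only [Set.mem_singleton_iff] at hx hy
        exact hxy (hx.trans hy.symm)
      · rintro x rfl y hy hyx
        exact h y (by simpa using (Set.mem_insert_iff.1 hy).resolve_left (by simpa using hyx))
    -- a color that misses `S` is cut by a vertex whose edge to `v` has a different color
    have inS : ∀ g g', g ≠ g' → ColorUsed f (insert v (S : Set α)) g →
        ColorUsed f (insert v (S : Set α)) g' → ColorUsed f S g := by
      intro g g' hgg' hg hg'
      by_contra h
      obtain ⟨u, hu, hvu⟩ := seen g' hg'
      refine hno g {u} hg ⟨by simp [hu], by simp, ?_, ?_⟩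
      · intro h'
        have : v ∈ ({u} : Set α) := h' ▸ Set.mem_insert _ _
        exact vne u hu this
      · rintro x rfl y hy hyx hxy
        rcases Set.mem_insert_iff.1 hy with rfl | hy
        · rw [hf, hvu] at hxy
          exact hgg' hxy.symm
        · exact h ⟨x, hu, y, hy, fun e => hyx e.symm, hxy⟩
    have hGS : NoRainbow f S := fun x hx y hy z hz =>
      hG x (Set.mem_insert_of_mem _ hx) y (Set.mem_insert_of_mem _ hy)
        z (Set.mem_insert_of_mem _ hz)
    obtain ⟨r, A, hr, hA⟩ := ih hGS hpq hps hqs (inS p q hpq hp hq) (inS q s hqs hq hs)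
      (inS s q hqs.symm hs hq)
    have hr' : ColorUsed f (insert v (S : Set α)) r := by
      obtain ⟨x, hx, y, hy, h⟩ := hr
      exact ⟨x, Set.mem_insert_of_mem _ hx, y, Set.mem_insert_of_mem _ hy, h⟩
    have hconn : ∀ x ∈ (S : Set α), ∃ y, Linked f S r x y ∧ f v y = r := by
      intro x hx
      by_contra! h
      refine hno r {y | Linked f S r x y} hr'
        ⟨fun y hy => Set.mem_insert_of_mem _ (Linked.mem hx hy), ⟨x, Relation.ReflTransGen.refl⟩,
          ?_, ?_⟩
      · intro h'
        have : v ∈ {y | Linked f S r x y} := h' ▸ Set.mem_insert _ _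
        exact hvS (Linked.mem hx this)
      · intro y hy z hz hyz hr
        rcases Set.mem_insert_iff.1 hz with rfl | hz
        · exact h y hy (by rw [hf, hr])
        · exact hyz (hy.tail ⟨Linked.mem hx hy, hz, fun e => hyz (e ▸ hy), hr⟩)
    -- two of the three colors differ from `r`, and both occur at `v`
    have two : ∀ g g', g ≠ g' → g ≠ r → g' ≠ r → ColorUsed f (insert v (S : Set α)) g →
        ColorUsed f (insert v (S : Set α)) g' → False := by
      intro g g' hne hgr hgr' hg hg'
      obtain ⟨u, hu, rfl⟩ := seen g hg
      obtain ⟨w, hw, rfl⟩ := seen g' hg'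
      exact hne (hG.eq_of_linked_insert hf hvS hA hconn hu hw hgr hgr')
    by_cases h1 : p = r
    · exact two q s hqs (fun h => hpq (h1.trans h.symm)) (fun h => hps (h1.trans h.symm)) hq hs
    · by_cases h2 : q = r
      · exact two p s hps h1 (fun h => hqs (h2.trans h.symm)) hp hs
      · exact two p q hpq h1 h2 hp hq

/-- A coloring with at least three colors and no rainbow triangle has a nontrivial homogeneous
set: a component of a disconnected color class that contains an edge. -/
theorem NoRainbow.exists_homogeneous [Fintype α] (hf : ∀ x y, f x y = f y x)
    (hG : NoRainbow f Set.univ) {p q s : K} (hpq : p ≠ q) (hps : p ≠ s) (hqs : q ≠ s)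
    (hp : ColorUsed f Set.univ p) (hq : ColorUsed f Set.univ q) (hs : ColorUsed f Set.univ s) :
    ∃ M : Finset α, 2 ≤ M.card ∧ M.card < Fintype.card α ∧
      ∀ w ∉ M, ∀ a ∈ M, ∀ b ∈ M, f w a = f w b := by
  classical
  rw [← Finset.coe_univ] at *
  obtain ⟨r, A, ⟨x, hx, y, hy, hxy, hr⟩, hA⟩ := hG.exists_isCut hf _ hpq hps hqs hp hq hs
  have hlink : Linked f (Finset.univ : Finset α) r x y :=
    Relation.ReflTransGen.single ⟨hx, hy, hxy, hr⟩
  refine ⟨Finset.univ.filter (Linked f (Finset.univ : Finset α) r x), ?_, ?_, ?_⟩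
  · refine Finset.one_lt_card.2 ⟨x, ?_, y, ?_, hxy⟩
    · exact Finset.mem_filter.2 ⟨Finset.mem_univ _, Relation.ReflTransGen.refl⟩
    · exact Finset.mem_filter.2 ⟨Finset.mem_univ _, hlink⟩
  · obtain ⟨z, -, hz⟩ := hA.exists_not_linked hf x
    exact Finset.card_lt_univ_of_notMem (x := z) fun h => hz (Finset.mem_filter.1 h).2
  · intro w hw a ha b hb
    simp only [Finset.mem_filter, Finset.mem_univ, true_and] at hw ha hb
    rw [hG.eq_of_linked hf (by simp) ha hw, hG.eq_of_linked hf (by simp) hb hw]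

end Structure

/-! ### Counting colorings by a homogeneous set -/

section Counting

open Finset SimpleGraph

variable {V W K : Type*}

theorem IsGallai.pullback {φ : TopEdgeLabeling V K} (h : IsGallai φ) (f : W ↪ V) :
    IsGallai (TopEdgeLabeling.pullback φ f) := fun x y z hxy hyz hxz =>
  h (f x) (f y) (f z) (f.injective.ne hxy) (f.injective.ne hyz) (f.injective.ne hxz)

theorem ncard_isGallai_le (V : Type*) [Fintype V] (k : ℕ) :
    {φ : TopEdgeLabeling V (Fin k) | IsGallai φ}.ncard ≤ c (Fintype.card V) k := by
  classical
  set e : Fin (Fintype.card V) ≃ V := (Fintype.equivFin V).symm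
  refine Set.ncard_le_ncard_of_injOn (fun φ => TopEdgeLabeling.pullback φ e.toEmbedding)
    (fun φ hφ => IsGallai.pullback hφ _) (fun φ _ ψ _ h => ?_) (Set.toFinite _)
  refine EdgeLabeling.ext_get fun x y hxy => ?_
  obtain ⟨x, rfl⟩ := e.surjective x
  obtain ⟨y, rfl⟩ := e.surjective y
  exact congrArg (fun χ => EdgeLabeling.get χ x y fun h => hxy (congrArg e h)) h

/-- Every vertex outside `M` sends edges of a single color to `M`. -/
def IsHomogeneous (φ : TopEdgeLabeling V K) (M : Finset V) : Prop :=
  ∀ (w a b : V) (hwa : w ≠ a) (hwb : w ≠ b), w ∉ M → a ∈ M → b ∈ M →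
    φ.get w a hwa = φ.get w b hwb

/-- A Gallai coloring that is homogeneous on `M` is determined by its restriction to `M` and by
the coloring obtained by contracting `M` to one of its vertices. -/
theorem ncard_isHomogeneous_le {n : ℕ} (k : ℕ) (M : Finset (Fin n)) (hM : M.Nonempty) :
    {φ : TopEdgeLabeling (Fin n) (Fin k) | IsGallai φ ∧ IsHomogeneous φ M}.ncard ≤
      c M.card k * c (n - M.card + 1) k := by
  obtain ⟨p, hp⟩ := hM
  set N : Finset (Fin n) := insert p Mᶜ
  have hN : Fintype.card N = n - M.card + 1 := by
    rw [Fintype.card_coe, card_insert_of_notMem (by simpa using hp), card_compl, Fintype.card_fin]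
  have h1 := ncard_isGallai_le M k
  have h2 := ncard_isGallai_le N k
  rw [Fintype.card_coe] at h1
  rw [hN] at h2
  refine le_trans ?_ (Nat.mul_le_mul h1 h2)
  rw [← Set.ncard_prod]
  refine Set.ncard_le_ncard_of_injOn (fun φ =>
    (TopEdgeLabeling.pullback φ (Function.Embedding.subtype (· ∈ M)),
      TopEdgeLabeling.pullback φ (Function.Embedding.subtype (· ∈ N))))
    (fun φ hφ => ⟨hφ.1.pullback _, hφ.1.pullback _⟩) (fun φ hφ ψ hψ h => ?_) (Set.toFinite _)
  have hφψM : ∀ x y (hxy : x ≠ y), x ∈ M → y ∈ M → φ.get x y hxy = ψ.get x y hxy :=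
    fun x y hxy hx hy => congrArg (fun χ => EdgeLabeling.get χ.1 (⟨x, hx⟩ : M) (⟨y, hy⟩ : M)
      fun e => hxy (congrArg Subtype.val e)) h
  have hφψN : ∀ x y (hxy : x ≠ y), x ∈ N → y ∈ N → φ.get x y hxy = ψ.get x y hxy :=
    fun x y hxy hx hy => congrArg (fun χ => EdgeLabeling.get χ.2 (⟨x, hx⟩ : N) (⟨y, hy⟩ : N)
      fun e => hxy (congrArg Subtype.val e)) h
  have hpN : p ∈ N := mem_insert_self _ _
  have hcN : ∀ x, x ∉ M → x ∈ N := fun x hx => mem_insert_of_mem (mem_compl.2 hx)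
  have cross : ∀ x y (hxy : x ≠ y), x ∉ M → y ∈ M → φ.get x y hxy = ψ.get x y hxy := by
    intro x y hxy hx hy
    have hxp : x ≠ p := by rintro rfl; exact hx hp
    rw [hφ.2 x y p hxy hxp hx hy hp, hψ.2 x y p hxy hxp hx hy hp]
    exact hφψN x p hxp (hcN x hx) hpN
  refine EdgeLabeling.ext_get fun x y hxy => ?_
  by_cases hx : x ∈ M <;> by_cases hy : y ∈ M
  · exact hφψM x y hxy hx hy
  · rw [EdgeLabeling.get_comm, EdgeLabeling.get_comm (C := ψ)]
    exact cross y x (Ne.symm hxy) hy hx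
  · exact cross x y hxy hx hy
  · exact hφψN x y hxy (hcN x hx) (hcN y hy)

theorem ncard_forall_mem {n k : ℕ} (P : Finset (Fin k)) :
    {φ : TopEdgeLabeling (Fin n) (Fin k) | ∀ e, φ e ∈ P}.ncard = P.card ^ n.choose 2 := by
  classical
  have : {φ : (⊤ : SimpleGraph (Fin n)).edgeSet → Fin k | ∀ e, φ e ∈ P} =
      (Fintype.piFinset fun _ => P : Finset ((⊤ : SimpleGraph (Fin n)).edgeSet → Fin k)) := by
    ext φ
    simp
  calc {φ : (⊤ : SimpleGraph (Fin n)).edgeSet → Fin k | ∀ e, φ e ∈ P}.ncard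
      = P.card ^ n.choose 2 := by
        rw [this, Set.ncard_coe_finset, Fintype.card_piFinset, prod_const, card_univ,
          ← edgeFinset_card, card_edgeFinset_top_eq_card_choose_two, Fintype.card_fin]

theorem IsGallai.exists_forall_mem_or_isHomogeneous {n k : ℕ} (hk : 2 ≤ k)
    {φ : TopEdgeLabeling (Fin n) (Fin k)} (hφ : IsGallai φ) :
    (∃ P : Finset (Fin k), P.card = 2 ∧ ∀ e, φ e ∈ P) ∨
      ∃ M : Finset (Fin n), 2 ≤ M.card ∧ M.card < n ∧ IsHomogeneous φ M := by
  classical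
  by_cases h3 : (univ.filter (· ∈ Set.range φ)).card ≤ 2
  · obtain ⟨P, hP, hcard⟩ := exists_superset_card_eq h3 (by simpa using hk)
    exact Or.inl ⟨P, hcard, fun e => hP (mem_filter.2 ⟨mem_univ _, e, rfl⟩)⟩
  · right
    obtain ⟨p, hp, q, hq, s, hs, hpq, hps, hqs⟩ := two_lt_card.1 (not_le.1 h3)
    set f : Fin n → Fin n → Fin k := fun x y => if h : x = y then p else φ.get x y h with hf
    have hget : ∀ x y (h : x ≠ y), f x y = φ.get x y h := fun x y h => dif_neg h
    have hsymm : ∀ x y, f x y = f y x := by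
      intro x y
      by_cases h : x = y
      · rw [h]
      · rw [hget x y h, hget y x (Ne.symm h), EdgeLabeling.get_comm]
    have hG : NoRainbow f Set.univ := by
      intro x _ y _ z _ hxy hyz hxz
      rw [hget _ _ hxy, hget _ _ hyz, hget _ _ hxz]
      exact hφ x y z hxy hyz hxz
    have hused : ∀ g ∈ univ.filter (· ∈ Set.range φ), ColorUsed f Set.univ g := by
      intro g hg
      obtain ⟨⟨e, he⟩, hg⟩ := (mem_filter.1 hg).2
      induction e using Sym2.inductionOn with
      | hf x y => exact ⟨x, trivial, y, trivial, he, (hget x y he).trans hg⟩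
    obtain ⟨M, h2, hM, hom⟩ := hG.exists_homogeneous hsymm hpq hps hqs (hused p hp) (hused q hq)
      (hused s hs)
    refine ⟨M, h2, by simpa using hM, fun w a b hwa hwb hw ha hb => ?_⟩
    rw [← hget w a hwa, ← hget w b hwb]
    exact hom w hw a ha b hb

theorem c_le (n : ℕ) {k : ℕ} (hk : 2 ≤ k) :
    c n k ≤ k.choose 2 * 2 ^ n.choose 2 +
      ∑ s ∈ Ico 2 n, n.choose s * (c s k * c (n - s + 1) k) := by
  classical
  set T : Finset (Finset (Fin n)) := univ.filter fun M => 2 ≤ M.card ∧ M.card < n with hT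
  have hsub : gallaiColorings n k ⊆
      (⋃ P ∈ powersetCard 2 (univ : Finset (Fin k)),
        {φ : TopEdgeLabeling (Fin n) (Fin k) | ∀ e, φ e ∈ P}) ∪
      ⋃ M ∈ T, {φ : TopEdgeLabeling (Fin n) (Fin k) | IsGallai φ ∧ IsHomogeneous φ M} := by
    intro φ hφ
    rcases IsGallai.exists_forall_mem_or_isHomogeneous hk hφ with ⟨P, hP, h⟩ | ⟨M, h2, hM, h⟩
    · exact Or.inl (Set.mem_biUnion (mem_powersetCard.2 ⟨subset_univ _, hP⟩) h)
    · exact Or.inr (Set.mem_biUnion (mem_filter.2 ⟨mem_univ _, h2, hM⟩) ⟨hφ, h⟩)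
  refine (Set.ncard_le_ncard hsub (Set.toFinite _)).trans ((Set.ncard_union_le _ _).trans ?_)
  refine add_le_add ((set_ncard_biUnion_le _ _).trans ?_) ((set_ncard_biUnion_le _ _).trans ?_)
  · rw [sum_congr rfl fun P hP => by rw [ncard_forall_mem P, (mem_powersetCard.1 hP).2]]
    simp
  · calc ∑ M ∈ T, {φ : TopEdgeLabeling (Fin n) (Fin k) | IsGallai φ ∧ IsHomogeneous φ M}.ncard
        ≤ ∑ M ∈ T, c M.card k * c (n - M.card + 1) k := by
          refine sum_le_sum fun M hM => ncard_isHomogeneous_le k M ?_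
          exact card_pos.1 (by have := (mem_filter.1 hM).2.1; omega)
      _ = ∑ M ∈ (univ : Finset (Fin n)).powerset,
            if 2 ≤ M.card ∧ M.card < n then c M.card k * c (n - M.card + 1) k else 0 := by
          rw [hT, sum_filter, powerset_univ]
      _ = ∑ s ∈ range (n + 1),
            n.choose s * (if 2 ≤ s ∧ s < n then c s k * c (n - s + 1) k else 0) := by
          rw [sum_powerset_apply_card
            (fun s => if 2 ≤ s ∧ s < n then c s k * c (n - s + 1) k else 0)]
          simp
      _ = ∑ s ∈ Ico 2 n, n.choose s * (c s k * c (n - s + 1) k) := by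
          rw [← sum_subset (s₁ := Ico 2 n)]
          · refine sum_congr rfl fun s hs => ?_
            rw [if_pos (mem_Ico.1 hs)]
          · intro s hs
            simp only [mem_Ico, mem_range] at *
            omega
          · intro s _ hs
            rw [if_neg (by simpa using hs), mul_zero]

/-- Every pair of colors supports all but two of its `2 ^ n.choose 2` colorings, the two
monochromatic ones. -/
theorem choose_mul_le_cTwo (n k : ℕ) :
    k.choose 2 * 2 ^ n.choose 2 ≤ cTwo n k + k.choose 2 * 2 := by
  classical
  set R : Finset (Fin k) → Set (TopEdgeLabeling (Fin n) (Fin k)) :=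
    fun P => {φ | usedColors φ = P} with hR
  have hpair : ∀ P ∈ powersetCard 2 (univ : Finset (Fin k)), 2 ^ n.choose 2 ≤ (R P).ncard + 2 := by
    intro P hP
    have hP2 := (mem_powersetCard.1 hP).2
    obtain ⟨a, b, hab, rfl⟩ := card_eq_two.1 hP2
    have hcard := ncard_forall_mem (n := n) ({a, b} : Finset (Fin k))
    rw [hP2] at hcard
    rw [← hcard]
    have hsub : {φ : TopEdgeLabeling (Fin n) (Fin k) | ∀ e, φ e ∈ ({a, b} : Finset (Fin k))} ⊆
        R {a, b} ∪ {(fun _ => a), (fun _ => b)} := by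
      intro φ hφ
      have hφ' : ∀ e, φ e = a ∨ φ e = b := fun e => by simpa using hφ e
      by_cases ha : ∃ e, φ e = a
      · by_cases hb : ∃ e, φ e = b
        · left
          refine Set.Subset.antisymm ?_ ?_
          · rintro _ ⟨e, rfl⟩
            exact hφ e
          · intro x hx
            rcases (by simpa using hx : x = a ∨ x = b) with rfl | rfl
            · exact ha
            · exact hb
        · right; left
          exact funext fun e => (hφ' e).resolve_right fun h => hb ⟨e, h⟩
      · right; right
        exact funext fun e => (hφ' e).resolve_left fun h => ha ⟨e, h⟩
    refine (Set.ncard_le_ncard hsub (Set.toFinite _)).trans ((Set.ncard_union_le _ _).trans ?_)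
    exact Nat.add_le_add_left ((Set.ncard_insert_le _ _).trans
      (Nat.succ_le_succ (Set.ncard_singleton _).le)) _
  have hdisj : ∑ P ∈ powersetCard 2 (univ : Finset (Fin k)), (R P).ncard ≤ cTwo n k := by
    rw [← finsum_mem_coe_finset, ← Set.Finite.ncard_biUnion (finite_toSet _)
      (fun _ _ => Set.toFinite _) ?_]
    · refine Set.ncard_le_ncard (Set.iUnion₂_subset fun P hP φ hφ => ⟨?_, ?_⟩) (Set.toFinite _)
      · have hP2 := (mem_powersetCard.1 hP).2
        have hmem : ∀ x y (h : x ≠ y), φ.get x y h ∈ P := fun x y h => by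
          rw [← mem_coe, ← show usedColors φ = P from hφ]
          exact Set.mem_range_self _
        rintro x y z hxy hyz hxz ⟨h1, h2, h3⟩
        exact absurd hP2 (two_lt_card.2 ⟨_, hmem x y hxy, _, hmem y z hyz, _, hmem x z hxz,
          h1, h3, h2⟩).ne'
      · rw [show usedColors φ = P from hφ, Set.ncard_coe_finset]
        exact (mem_powersetCard.1 hP).2
    · intro P _ Q _ hPQ
      refine Set.disjoint_left.2 fun φ hφP hφQ => hPQ (coe_injective ?_)
      exact (show usedColors φ = P from hφP).symm.trans hφQ
  calc k.choose 2 * 2 ^ n.choose 2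
      = ∑ P ∈ powersetCard 2 (univ : Finset (Fin k)), 2 ^ n.choose 2 := by simp
    _ ≤ ∑ P ∈ powersetCard 2 (univ : Finset (Fin k)), ((R P).ncard + 2) := sum_le_sum hpair
    _ ≤ _ := by
      rw [sum_add_distrib]
      simpa using hdisj

theorem cTwo_le_c (n k : ℕ) : cTwo n k ≤ c n k :=
  Set.ncard_le_ncard (fun _ h => h.1) (Set.toFinite _)

end Counting

/-! ### The recursive inequality for the normalized counts -/

section Recursion

open Finset

theorem choose_two_add_one_add (t u : ℕ) :
    (t + 1 + u).choose 2 = (t + 1).choose 2 + (u + 1).choose 2 + t * u := by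
  have h : ((t + 1 + u).choose 2 : ℚ) = (t + 1).choose 2 + (u + 1).choose 2 + t * u := by
    simp only [Nat.cast_choose_two]
    push_cast
    ring
  exact_mod_cast h

/-- The number of Gallai colorings relative to the number `2 ^ m.choose 2` of colorings with a
fixed pair of colors. -/
noncomputable def ratio (k m : ℕ) : ℝ := c m k / 2 ^ m.choose 2

theorem ratio_nonneg (k m : ℕ) : 0 ≤ ratio k m := by unfold ratio; positivity

theorem ratio_le {k : ℕ} (hk : 2 ≤ k) (m : ℕ) :
    ratio k m ≤ k.choose 2 + ∑ s ∈ Ico 2 m,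
      m.choose s * (ratio k s * ratio k (m - s + 1)) / 2 ^ ((s - 1) * (m - s)) := by
  have h : (c m k : ℝ) ≤ k.choose 2 * 2 ^ m.choose 2 +
      ∑ s ∈ Ico 2 m, (m.choose s : ℝ) * (c s k * c (m - s + 1) k) := by
    exact_mod_cast c_le m hk
  rw [ratio, div_le_iff₀ (by positivity), add_mul, sum_mul]
  refine h.trans (add_le_add_right (sum_le_sum fun s hs => le_of_eq ?_) _)
  rw [mem_Ico] at hs
  obtain ⟨t, rfl⟩ : ∃ t, s = t + 1 := ⟨s - 1, by omega⟩
  obtain ⟨u, rfl⟩ : ∃ u, m = t + 1 + u := ⟨m - (t + 1), by omega⟩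
  rw [Nat.add_sub_cancel_left, Nat.add_sub_cancel, choose_two_add_one_add, pow_add, pow_add]
  unfold ratio
  field_simp

variable {a : ℕ → ℝ} {K : ℝ} {n r : ℕ}

/-- A crude bound, which is effective only for small `m`. The weights
`m.choose s / 2 ^ ((s - 1) * (m - s))` are at most `4`, so they add up to at most `B / 2`, and the
exponent `2 * m - 3` is such that the bounds on `a s` and `a (m - s + 1)` multiply to
`B ^ (2 * m - 4)`, which leaves one factor `B` to spare. -/
theorem le_pow_of_recursion (ha : ∀ m, 0 ≤ a m)
    (hrec : ∀ m, a m ≤ K + ∑ s ∈ Ico 2 m,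
      m.choose s * (a s * a (m - s + 1)) / 2 ^ ((s - 1) * (m - s)))
    {B : ℝ} (hB1 : 1 ≤ B) (hB : 8 * n ≤ B) (hK : K ≤ B / 2) (m : ℕ) (hm : 2 ≤ m) (hmn : m ≤ n) :
    a m ≤ B ^ (2 * m - 3) := by
  induction m using Nat.strong_induction_on with
  | _ m ih =>
  rcases hm.eq_or_lt with rfl | hm3
  · refine (hrec 2).trans ?_
    simp only [Ico_self, sum_empty]
    norm_num
    linarith
  have hmR : (m : ℝ) ≤ n := by exact_mod_cast hmn
  have hterm : ∀ s ∈ Ico 2 m,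
      m.choose s * (a s * a (m - s + 1)) / 2 ^ ((s - 1) * (m - s)) ≤ 4 * B ^ (2 * m - 4) := by
    intro s hs
    rw [mem_Ico] at hs
    have h1 := ih s (by omega) (by omega) (by omega)
    have h2 := ih (m - s + 1) (by omega) (by omega) (by omega)
    have h3 : a s * a (m - s + 1) ≤ B ^ (2 * m - 4) := by
      calc a s * a (m - s + 1) ≤ B ^ (2 * s - 3) * B ^ (2 * (m - s + 1) - 3) :=
            mul_le_mul h1 h2 (ha _) (by positivity)
        _ = B ^ (2 * m - 4) := by rw [← pow_add]; congr 1; omega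
    have h4 : (m.choose s : ℝ) ≤ 4 * 2 ^ ((s - 1) * (m - s)) := by
      obtain ⟨t, rfl⟩ : ∃ t, s = t + 2 := ⟨s - 2, by omega⟩
      obtain ⟨u, rfl⟩ : ∃ u, m = t + 2 + (u + 1) := ⟨m - (t + 2) - 1, by omega⟩
      rw [show t + 2 - 1 = t + 1 by omega, Nat.add_sub_cancel_left,
        show (4 : ℝ) = 2 ^ 2 by norm_num, ← pow_add]
      calc ((t + 2 + (u + 1)).choose (t + 2) : ℝ) ≤ 2 ^ (t + 2 + (u + 1)) := by
            exact_mod_cast Nat.choose_le_two_pow _ _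
        _ ≤ _ := pow_le_pow_right₀ (by norm_num) (by nlinarith [Nat.zero_le (t * u)])
    rw [div_le_iff₀ (by positivity)]
    calc m.choose s * (a s * a (m - s + 1))
        ≤ (4 * 2 ^ ((s - 1) * (m - s))) * B ^ (2 * m - 4) :=
          mul_le_mul h4 h3 (mul_nonneg (ha _) (ha _)) (by positivity)
      _ = _ := by ring
  have hsum : ∑ s ∈ Ico 2 m, m.choose s * (a s * a (m - s + 1)) / 2 ^ ((s - 1) * (m - s)) ≤
      m * (4 * B ^ (2 * m - 4)) := by
    refine (sum_le_card_nsmul _ _ _ hterm).trans ?_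
    rw [nsmul_eq_mul, Nat.card_Ico]
    gcongr
    omega
  have hpow : B ^ (2 * m - 3) = B ^ (2 * m - 4) * B := by
    rw [← pow_succ]; congr 1; omega
  have h5 : B ≤ B ^ (2 * m - 3) := le_self_pow₀ hB1 (by omega)
  have h6 : m * (4 * B ^ (2 * m - 4)) ≤ B ^ (2 * m - 3) / 2 := by
    rw [hpow]
    have : 0 ≤ B ^ (2 * m - 4) := by positivity
    nlinarith
  have := hrec m
  linarith

/-- The part `2 ^ (400 * r ^ 2 - 4 * r * m)` of the bound on `a m` that decays with `m`. -/
noncomputable def decay (r m : ℕ) : ℝ := 2 ^ (400 * r ^ 2) / 2 ^ (4 * r * m)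

theorem decay_nonneg (r m : ℕ) : 0 ≤ decay r m := by unfold decay; positivity

/-- One summand of the recursion, with `t` the smaller of the two parameters. The factor
`2 ^ (t * u)` beats the crude bound on the smaller part, the binomial coefficient and the loss
`2 ^ (4 * r * t)` in the decay. -/
theorem term_le {t u : ℕ} (ht : 1 ≤ t) (hu : 20 * r ≤ u) {C X Y L : ℝ} (hX0 : 0 ≤ X) (hY0 : 0 ≤ Y)
    (hL : 0 ≤ L) (hC : C ≤ 2 ^ (r * t)) (hX : X ≤ 2 ^ (6 * r * t)) (hY : Y ≤ L + decay r (u + 1)) :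
    C * (X * Y) / 2 ^ (t * u) ≤ (L + decay r (t + 1 + u)) / 2 ^ (9 * r) := by
  have hd : decay r (u + 1) = 2 ^ (4 * r * t) * decay r (t + 1 + u) := by
    unfold decay
    rw [show 4 * r * (t + 1 + u) = 4 * r * t + 4 * r * (u + 1) by ring, pow_add]
    field_simp
  have hD := decay_nonneg r (t + 1 + u)
  have h1 : (1 : ℝ) ≤ 2 ^ (4 * r * t) := one_le_pow₀ (by norm_num)
  have hY' : Y ≤ 2 ^ (4 * r * t) * (L + decay r (t + 1 + u)) := by
    rw [hd] at hY
    nlinarith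
  rw [div_le_div_iff₀ (by positivity) (by positivity)]
  have hexp : 9 * r + (r * t + 6 * r * t + 4 * r * t) ≤ t * u := by
    have h2 : t * (20 * r) ≤ t * u := Nat.mul_le_mul_left _ hu
    have h3 : r * 1 ≤ r * t := Nat.mul_le_mul_left _ ht
    nlinarith
  have hL' : 0 ≤ L + decay r (t + 1 + u) := by positivity
  calc C * (X * Y) * 2 ^ (9 * r)
      ≤ 2 ^ (r * t) * (2 ^ (6 * r * t) * (2 ^ (4 * r * t) * (L + decay r (t + 1 + u)))) *
          2 ^ (9 * r) := by gcongr
    _ = (L + decay r (t + 1 + u)) * 2 ^ (9 * r + (r * t + 6 * r * t + 4 * r * t)) := by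
        rw [pow_add, pow_add, pow_add]; ring
    _ ≤ _ := by gcongr; norm_num

/-- One use of the recursion, with the crude bound on the smaller part of each summand and the
inductive bound on the larger one; the factor `2 ^ r` bounds the number of summands. -/
theorem le_add_of_recursion_step (ha : ∀ m, 0 ≤ a m)
    (hrec : ∀ m, a m ≤ K + ∑ s ∈ Ico 2 m,
      m.choose s * (a s * a (m - s + 1)) / 2 ^ ((s - 1) * (m - s)))
    (hn : n ^ 2 ≤ 2 ^ r) {L : ℝ} (hL : 0 ≤ L)
    (hcrude : ∀ m, 2 ≤ m → m ≤ n → a m ≤ 2 ^ (6 * r * (m - 1)))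
    {m : ℕ} (hm : 40 * r < m) (hmn : m ≤ n)
    (ih : ∀ j, 2 ≤ j → j < m → a j ≤ L + decay r j) :
    a m ≤ K + 2 ^ r * ((L + decay r m) / 2 ^ (9 * r)) := by
  have hpow : ∀ t, 1 ≤ t → (m : ℝ) ^ (t + 1) ≤ 2 ^ (r * t) := by
    intro t ht
    have h : m ^ (t + 1) ≤ 2 ^ (r * t) := calc
      m ^ (t + 1) ≤ n ^ (t + 1) := Nat.pow_le_pow_left hmn _
      _ ≤ n ^ (2 * t) := Nat.pow_le_pow_right (by omega) (by omega)
      _ = (n ^ 2) ^ t := pow_mul _ _ _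
      _ ≤ (2 ^ r) ^ t := Nat.pow_le_pow_left hn _
      _ = 2 ^ (r * t) := (pow_mul _ _ _).symm
    exact_mod_cast h
  have hterm : ∀ s ∈ Ico 2 m, m.choose s * (a s * a (m - s + 1)) / 2 ^ ((s - 1) * (m - s)) ≤
      (L + decay r m) / 2 ^ (9 * r) := by
    intro s hs
    rw [mem_Ico] at hs
    obtain ⟨t, rfl⟩ : ∃ t, s = t + 1 := ⟨s - 1, by omega⟩
    obtain ⟨u, rfl⟩ : ∃ u, m = t + 1 + u := ⟨m - (t + 1), by omega⟩
    rw [Nat.add_sub_cancel_left, Nat.add_sub_cancel]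
    have hct := hcrude (t + 1) (by omega) (by omega)
    have hcu := hcrude (u + 1) (by omega) (by omega)
    rw [Nat.add_sub_cancel] at hct hcu
    rcases le_total t u with htu | hut
    · refine term_le (by omega) (by omega) (ha _) (ha _) hL ?_ hct (ih _ (by omega) (by omega))
      refine le_trans ?_ (hpow t (by omega))
      exact_mod_cast Nat.choose_le_pow _ _
    · rw [mul_comm (a (t + 1)), mul_comm t, show t + 1 + u = u + 1 + t by omega]
      refine term_le (by omega) (by omega) (ha _) (ha _) hL ?_ hcu (ih _ (by omega) (by omega))
      rw [show u + 1 + t = t + 1 + u by omega]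
      refine le_trans ?_ (hpow u (by omega))
      rw [show (t + 1 + u).choose (t + 1) = (t + 1 + u).choose u from
        Nat.choose_symm_of_eq_add rfl]
      calc ((t + 1 + u).choose u : ℝ) ≤ ((t + 1 + u : ℕ) : ℝ) ^ u := by
            exact_mod_cast Nat.choose_le_pow _ _
        _ ≤ _ := pow_le_pow_right₀ (by exact_mod_cast (by omega : 1 ≤ t + 1 + u)) (by omega)
  refine (hrec m).trans (add_le_add_right ((sum_le_card_nsmul _ _ _ hterm).trans ?_) _)
  rw [nsmul_eq_mul, Nat.card_Ico]
  have hm2 : ((m - 2 : ℕ) : ℝ) ≤ 2 ^ r := by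
    have : m - 2 ≤ 2 ^ r := by nlinarith [Nat.sub_le m 2]
    exact_mod_cast this
  have := decay_nonneg r m
  gcongr

/-- The sharp bound: for `n` large compared to `r`, the recursion leaves only the main term. -/
theorem le_add_inv_of_recursion (ha : ∀ m, 0 ≤ a m)
    (hrec : ∀ m, a m ≤ K + ∑ s ∈ Ico 2 m,
      m.choose s * (a s * a (m - s + 1)) / 2 ^ ((s - 1) * (m - s)))
    (hr : 1 ≤ r) (hn : n ^ 2 ≤ 2 ^ r) (hn8 : 8 * n ≤ 2 ^ r) (hrn : 100 * r ≤ n)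
    (hK : K ≤ 2 ^ (2 * r) / 2) : a n ≤ K + 1 / 2 ^ r := by
  have h2r : (2 : ℝ) ≤ 2 ^ r := by simpa using pow_le_pow_right₀ (one_le_two (α := ℝ)) hr
  have hcrude : ∀ m, 2 ≤ m → m ≤ n → a m ≤ 2 ^ (6 * r * (m - 1)) := by
    intro m hm hmn
    have h := le_pow_of_recursion (B := 2 ^ (3 * r)) ha hrec (one_le_pow₀ (by norm_num))
      (n := n) ?_ ?_ m hm hmn
    · refine h.trans ?_
      rw [← pow_mul]
      refine pow_le_pow_right₀ (by norm_num) ?_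
      rw [show 6 * r * (m - 1) = 3 * r * (2 * (m - 1)) by ring]
      exact Nat.mul_le_mul_left _ (by omega)
    · have : (8 * n : ℝ) ≤ 2 ^ r := by exact_mod_cast hn8
      exact this.trans (pow_le_pow_right₀ (by norm_num) (by omega))
    · have : (2 : ℝ) ^ (2 * r) ≤ 2 ^ (3 * r) := pow_le_pow_right₀ (by norm_num) (by omega)
      linarith
  have hL : (0 : ℝ) ≤ 2 ^ (2 * r) := by positivity
  have hbound : ∀ m, 2 ≤ m → m ≤ n → a m ≤ 2 ^ (2 * r) + decay r m := by
    intro m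
    induction m using Nat.strong_induction_on with
    | _ m ih =>
    intro hm hmn
    rcases le_or_gt m (40 * r) with hmr | hmr
    · have h1 : (2 : ℝ) ^ (6 * r * (m - 1)) ≤ decay r m := by
        unfold decay
        rw [le_div_iff₀ (by positivity), ← pow_add]
        refine pow_le_pow_right₀ (by norm_num) ?_
        have h2 : 6 * r * (m - 1) ≤ 6 * r * m := Nat.mul_le_mul_left _ (by omega)
        have h3 : r * m ≤ r * (40 * r) := Nat.mul_le_mul_left _ hmr
        nlinarith
      linarith [hcrude m hm hmn]
    · have h := le_add_of_recursion_step ha hrec hn hL hcrude hmr hmn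
        fun j hj hjm => ih j hjm hj (by omega)
      have hD := decay_nonneg r m
      have h1 : 2 ^ r * ((2 ^ (2 * r) + decay r m) / 2 ^ (9 * r)) ≤
          (2 ^ (2 * r) + decay r m) / 2 := by
        rw [← mul_div_assoc, div_le_div_iff₀ (by positivity) (by norm_num)]
        have h2 : (2 : ℝ) ^ r * 2 ≤ 2 ^ (9 * r) := by
          rw [← pow_succ]; exact pow_le_pow_right₀ (by norm_num) (by omega)
        nlinarith
      linarith
  have h := le_add_of_recursion_step ha hrec hn hL hcrude (m := n) (by omega) le_rfl
    fun j hj hjn => hbound j hj hjn.le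
  have hD : decay r n ≤ 1 := by
    unfold decay
    rw [div_le_one (by positivity)]
    refine pow_le_pow_right₀ (by norm_num) ?_
    have : 4 * r * (100 * r) ≤ 4 * r * n := Nat.mul_le_mul_left _ hrn
    nlinarith
  refine h.trans (add_le_add_right ?_ _)
  have h1 : (1 : ℝ) ≤ 2 ^ (2 * r) := one_le_pow₀ (by norm_num)
  rw [← mul_div_assoc, div_le_div_iff₀ (by positivity) (by positivity), one_mul]
  calc (2 : ℝ) ^ r * (2 ^ (2 * r) + decay r n) * 2 ^ r
      ≤ 2 ^ r * (2 ^ (2 * r) * 2) * 2 ^ r := by gcongr; linarith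
    _ = 2 ^ (4 * r + 1) := by ring
    _ ≤ _ := pow_le_pow_right₀ (by norm_num) (by omega)

end Recursion

/-! ### Asymptotics -/

theorem choose_two_le_half_sq (k : ℕ) : (k.choose 2 : ℝ) ≤ (k : ℝ) ^ 2 / 2 := by
  rw [Nat.cast_choose_two]
  nlinarith [(Nat.cast_nonneg k : (0 : ℝ) ≤ k)]

/-- Everything that has to hold for large `n`, in terms of `r = n / 4300 + 1`, for which
`k ≤ 2 ^ r`. -/
theorem exists_forall_large {ε : ℝ} (hε : 0 < ε) : ∃ n₀ : ℕ, ∀ n, n₀ ≤ n →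
    ∃ r : ℕ, 1 ≤ r ∧ (n : ℝ) / 4300 ≤ r ∧ n ^ 2 ≤ 2 ^ r ∧ 8 * n ≤ 2 ^ r ∧ 100 * r ≤ n ∧
      1 / 2 ^ r ≤ ε := by
  have h1 : ∀ᶠ r : ℕ in Filter.atTop, (r : ℝ) ^ 2 / 2 ^ r < 1 / 4300 ^ 2 :=
    (tendsto_pow_const_div_const_pow_of_one_lt 2 (by norm_num)).eventually_lt_const (by norm_num)
  have h2 : ∀ᶠ r : ℕ in Filter.atTop, (r : ℝ) ^ 2 / 2 ^ r < ε :=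
    (tendsto_pow_const_div_const_pow_of_one_lt 2 (by norm_num)).eventually_lt_const hε
  obtain ⟨R, hR⟩ := Filter.eventually_atTop.1 (h1.and h2)
  refine ⟨4300 * (R + 1), fun n hn => ?_⟩
  obtain ⟨h1, h2⟩ := hR (n / 4300 + 1) (by omega)
  have hlt : n < 4300 * (n / 4300 + 1) := by omega
  generalize hr : n / 4300 + 1 = r at h1 h2 hlt
  have hr1 : (1 : ℝ) ≤ r := by exact_mod_cast (by omega : 1 ≤ r)
  have hltR : (n : ℝ) < 4300 * r := by exact_mod_cast hlt
  have hsq : n ^ 2 ≤ 2 ^ r := by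
    rw [div_lt_div_iff₀ (by positivity) (by positivity)] at h1
    have : (n : ℝ) ^ 2 ≤ 2 ^ r := by
      nlinarith [(Nat.cast_nonneg n : (0 : ℝ) ≤ n)]
    exact_mod_cast this
  refine ⟨r, by omega, by linarith, hsq, by nlinarith, by omega, le_trans ?_ h2.le⟩
  gcongr
  nlinarith

end GallaiColoring

theorem theorem1 :
    ∀ ε : ℝ, 0 < ε → ∃ n₀ : ℕ, ∀ n : ℕ, n₀ ≤ n → ∀ k : ℕ, 2 < k →
      (k : ℝ) ≤ (2 : ℝ) ^ ((n : ℝ) / 4300) →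
        |(GallaiColoring.c n k : ℝ) - (k.choose 2 : ℝ) * (2 : ℝ) ^ (n.choose 2)|
            ≤ ε * (2 : ℝ) ^ (n.choose 2) ∧
          (1 - ε) * (GallaiColoring.c n k : ℝ) ≤ (GallaiColoring.cTwo n k : ℝ) := by
  intro ε hε
  obtain ⟨n₀, hn₀⟩ := GallaiColoring.exists_forall_large (half_pos hε)
  refine ⟨n₀, fun n hn k hk hkn => ?_⟩
  obtain ⟨r, hr, hnr, hsq, h8, h100, hεr⟩ := hn₀ n hn
  have hk2r : (k : ℝ) ^ 2 ≤ 2 ^ (2 * r) := by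
    have : (k : ℝ) ≤ 2 ^ r := by
      refine hkn.trans ?_
      rw [← Real.rpow_natCast]
      exact Real.rpow_le_rpow_of_exponent_le (by norm_num) hnr
    rw [mul_comm 2 r, pow_mul]
    gcongr
  have hK := GallaiColoring.choose_two_le_half_sq k
  have hE : 3 * r ≤ n.choose 2 := by
    obtain ⟨j, rfl⟩ : ∃ j, n = j + 1 := ⟨n - 1, by omega⟩
    have : (j + 1).choose 2 = j + j.choose 2 := by
      rw [Nat.choose_succ_succ' j 1, Nat.choose_one_right]
    omega
  have hupper : (GallaiColoring.c n k : ℝ) ≤ (k.choose 2 + ε / 2) * 2 ^ n.choose 2 := by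
    rw [← div_le_iff₀ (by positivity)]
    refine (GallaiColoring.le_add_inv_of_recursion (GallaiColoring.ratio_nonneg k)
      (GallaiColoring.ratio_le hk.le) hr hsq h8 h100 (by linarith)).trans ?_
    linarith
  have hlower : (k.choose 2 - ε / 2) * 2 ^ n.choose 2 ≤ (GallaiColoring.cTwo n k : ℝ) := by
    have h1 : (k.choose 2 * 2 ^ n.choose 2 : ℝ) ≤ GallaiColoring.cTwo n k + k.choose 2 * 2 := by
      exact_mod_cast GallaiColoring.choose_mul_le_cTwo n k
    have h2 : (2 : ℝ) ^ (2 * r) ≤ ε / 2 * 2 ^ n.choose 2 := by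
      calc (2 : ℝ) ^ (2 * r) = 1 / 2 ^ r * 2 ^ (3 * r) := by
            rw [show 3 * r = 2 * r + r by ring, pow_add (2 : ℝ) (2 * r) r]; field_simp
        _ ≤ ε / 2 * 2 ^ n.choose 2 := by gcongr; norm_num
    linarith
  have hle : (GallaiColoring.cTwo n k : ℝ) ≤ GallaiColoring.c n k := by
    exact_mod_cast GallaiColoring.cTwo_le_c n k
  have hpos : (0 : ℝ) < 2 ^ n.choose 2 := by positivity
  have hεpos := mul_pos hε hpos
  refine ⟨abs_le.2 ⟨by nlinarith, by nlinarith⟩, ?_⟩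
  rcases le_total 1 ε with h | h
  · exact (mul_nonpos_of_nonpos_of_nonneg (by linarith) (by positivity)).trans (by positivity)
  · have hK1 : (1 : ℝ) ≤ k.choose 2 := by exact_mod_cast Nat.choose_pos hk.le
    calc (1 - ε) * (GallaiColoring.c n k : ℝ)
        ≤ (1 - ε) * ((k.choose 2 + ε / 2) * 2 ^ n.choose 2) := by gcongr
      _ = ((1 - ε) * (k.choose 2 + ε / 2)) * 2 ^ n.choose 2 := by ring
      _ ≤ (k.choose 2 - ε / 2) * 2 ^ n.choose 2 := by gcongr; nlinarith
      _ ≤ _ := hlower
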